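/- Let $M$ be a compact connected smooth manifold of dimension $4m$ with a $4$-plectic form $\psi$, i.e. a smooth closed $4$-form such that $v\mapsto\iota_v\psi$ is injective on every tangent space. Let $Sp(1)^m$ (a product of $m$ copies of the unit quaternions) act smoothly on $M$ in generalized Hamiltonian fashion: the action preserves $\psi$, and for every $U\in\mathfrak{sp}(1)^m$, with fundamental vector field $\widehat U_p=\frac{d}{dt}\big|_{t=0}\exp(tU)\cdot p$, the $3$-form $\iota_{\widehat U}\psi$ is exact. Let $H,X,Y$ be the basis of $\mathfrak{sp}(1)$ corresponding to the quaternions $i,j,k$, write $u^i$ for $u\in\mathfrak{sp}(1)$ placed in the $i$-th summand of $\mathfrak{sp}(1)^m$, and identify $\Lambda^3\mathfrak{sp}(1)$ with $\mathbb R$ by $X\wedge Y\wedge H\mapsto 1$. Let $\sigma=(\sigma_1,\dots,\sigma_m):M\to((\Lambda^3\mathfrak{sp}(1))^m)^*\cong\mathbb R^m$ be a tri-moment map: a smooth $Sp(1)^m$-invariant map such that, for all $\delta=(U_i\wedge V_i\wedge W_i)_{i=1}^m\in(\Lambda^3\mathfrak{sp}(1))^m$, $p\in M$ and $v\in T_pM$,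 $$d\sigma_p(v)(\delta)=\sum_{i=1}^m\psi_p\big(v,\widehat{U_i^i},\widehat{V_i^i},\widehat{W_i^i}\big).$$ Assume that $\psi$ is partitioned strongly non-degenerate, i.e. there are the following data. 1. For each $p\in M$ there is a decomposition $T_pM=\bigoplus_{i=1}^mV_i$ into $4$-dimensional subspaces such that $V_i$ contains $v_1^i=\widehat{H^i}_p$, $v_2^i=\widehat{X^i}_p$, $v_3^i=\widehat{Y^i}_p$, the restriction of $\psi_p$ to each $V_i$ is non-degenerate, and $\psi_p$ vanishes whenever two of its arguments lie in two different summands $V_i$, $V_j$. 2. There are linear isomorphisms $L_\psi:\Lambda^3V_i\to V_i$ at each point and a smooth non-degenerate symmetric bilinear form (metric) $g$ on $TM$ with $g_p(v,L_\psi(a\wedge b\wedge c))=\psi_p(v,a,b,c)$ for all $v\in T_pM$, all $k$ and all $a,b,c\in V_k$. Put $v_4^i=L_\psi(v_1^i\wedge v_2^i\wedge v_3^i)$. At each point where the $3m$ vectors $v_1^i,v_2^i,v_3^i$ ($i=1,\dots,m$) are linearly independent, the $4m$ vectors $v_1^i,\dots,v_4^i$ form a basis of $T_pM$ in which $g_p$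 is diagonal. Suppose moreover that $v_4^j\big(g(v_4^k,v_4^k)\big)=0$ on $M$ for all $j\neq k$ in $\{1,\dots,m\}$. Then the set $A=\sigma\big(\bigcap_{i=1}^m\operatorname{Crit}\sigma_i\big)$ is finite and $\sigma(M)$ is contained in the convex hull of $A$. -/

import Mathlib

open scoped Manifold ContDiff Quaternion

noncomputable section

namespace Plectic

/-! ### Differential forms on a manifold without boundary -/

section Forms

variable {d : ℕ} (M : Type*) [TopologicalSpace M] [ChartedSpace (EuclideanSpace ℝ (Fin d)) M]

/-- A (not necessarily smooth) differential `n`-form on the `d`-dimensional manifold `M`. -/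
abbrev Form (d : ℕ) (M : Type*) [TopologicalSpace M]
    [ChartedSpace (EuclideanSpace ℝ (Fin d)) M] (n : ℕ) : Type _ :=
  ∀ p : M, (TangentSpace (𝓡 d) p) [⋀^Fin n]→L[ℝ] ℝ

variable {M}

/-- The coordinate expression of a form in the preferred chart at `x₀`, i.e. its pullback under
the inverse of that chart. It is meaningful on the (open) target of the chart. -/
def Form.inChart {n : ℕ} (β : Form d M n) (x₀ : M) (y : EuclideanSpace ℝ (Fin d)) :
    (EuclideanSpace ℝ (Fin d)) [⋀^Fin n]→L[ℝ] ℝ :=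
  (β ((extChartAt (𝓡 d) x₀).symm y)).compContinuousLinearMap
    (mfderiv 𝓘(ℝ, EuclideanSpace ℝ (Fin d)) (𝓡 d) (extChartAt (𝓡 d) x₀).symm y)

/-- A form is smooth if all its coordinate expressions are. -/
def Form.IsSmooth {n : ℕ} (β : Form d M n) : Prop :=
  ∀ x₀ : M, ContDiffOn ℝ ∞ (β.inChart x₀) (extChartAt (𝓡 d) x₀).target

/-- `α = dβ`: the exterior derivative is computed in charts. -/
def Form.IsExtDerivOf {n : ℕ} (α : Form d M (n + 1)) (β : Form d M n) : Prop :=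
  ∀ x₀ : M, ∀ y ∈ (extChartAt (𝓡 d) x₀).target, α.inChart x₀ y = extDeriv (β.inChart x₀) y

/-- `dβ = 0`. -/
def Form.IsClosed {n : ℕ} (β : Form d M n) : Prop :=
  Form.IsExtDerivOf 0 β

/-- `α = dη` for some smooth form `η`. -/
def Form.IsExact {n : ℕ} (α : Form d M (n + 1)) : Prop :=
  ∃ η : Form d M n, η.IsSmooth ∧ α.IsExtDerivOf η

/-- The contraction `ι_X β = β(X, ·, …, ·)` of a form along a vector field. -/
def Form.contract {n : ℕ} (β : Form d M (n + 1)) (X : ∀ p : M, TangentSpace (𝓡 d) p) :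
    Form d M n :=
  fun p => ContinuousAlternatingMap.curryLeft (E := EuclideanSpace ℝ (Fin d)) (β p) (X p)

/-- A `4`-plectic form: smooth, closed, and non-degenerate in the sense that `v ↦ ι_v ψ` is
injective on every tangent space. -/
structure IsFourPlectic (ψ : Form d M 4) : Prop where
  smooth : ψ.IsSmooth
  closed : ψ.IsClosed
  nondegenerate : ∀ (p : M) (v : TangentSpace (𝓡 d) p),
    (∀ a b c : TangentSpace (𝓡 d) p, ψ p ![v, a, b, c] = 0) → v = 0

variable (d M) in
/-- A field of bilinear forms on the tangent spaces. -/
abbrev BilinField : Type _ :=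
  ∀ p : M, TangentSpace (𝓡 d) p →L[ℝ] TangentSpace (𝓡 d) p →L[ℝ] ℝ

/-- The coordinate expression of a field of bilinear forms in the preferred chart at `x₀`. -/
def BilinField.inChart (g : BilinField d M) (x₀ : M) (y : EuclideanSpace ℝ (Fin d)) :
    EuclideanSpace ℝ (Fin d) →L[ℝ] EuclideanSpace ℝ (Fin d) →L[ℝ] ℝ :=
  ContinuousLinearMap.bilinearComp (E := EuclideanSpace ℝ (Fin d))
    (F := EuclideanSpace ℝ (Fin d)) (g ((extChartAt (𝓡 d) x₀).symm y))
    (mfderiv 𝓘(ℝ, EuclideanSpace ℝ (Fin d)) (𝓡 d) (extChartAt (𝓡 d) x₀).symm y)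
    (mfderiv 𝓘(ℝ, EuclideanSpace ℝ (Fin d)) (𝓡 d) (extChartAt (𝓡 d) x₀).symm y)

/-- A smooth non-degenerate metric; positive definiteness is not required. -/
structure IsMetric (g : BilinField d M) : Prop where
  smooth : ∀ x₀ : M, ContDiffOn ℝ ∞ (g.inChart x₀) (extChartAt (𝓡 d) x₀).target
  symm : ∀ (p : M) (v w : TangentSpace (𝓡 d) p), g p v w = g p w v
  nondegenerate : ∀ (p : M) (v : TangentSpace (𝓡 d) p),
    (∀ w : TangentSpace (𝓡 d) p, g p v w = 0) → v = 0

end Forms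

/-! ### The group `Sp(1)^m` and its Lie algebra -/

/-- The group `Sp(1)` of unit quaternions. -/
abbrev Sp1 : Type := Metric.sphere (0 : ℍ[ℝ]) 1

instance factFinrankQuaternion : Fact (Module.finrank ℝ ℍ[ℝ] = 3 + 1) :=
  ⟨Quaternion.finrank_eq_four⟩

/-- The Lie algebra `sp(1)`: the purely imaginary quaternions. -/
def sp1 : Submodule ℝ ℍ[ℝ] where
  carrier := {q | q.re = 0}
  add_mem' := by
    intro a b ha hb
    simp only [Set.mem_ofPred_eq] at *
    simp [ha, hb]
  zero_mem' := by simp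
  smul_mem' := by
    intro c a ha
    simp only [Set.mem_ofPred_eq] at *
    simp [ha]

/-- The standard basis `H, X, Y` of `sp(1)`, corresponding to the imaginary units `i, j, k`. -/
def basisH : sp1 := ⟨⟨0, 1, 0, 0⟩, rfl⟩

/-- See `basisH`. -/
def basisX : sp1 := ⟨⟨0, 0, 1, 0⟩, rfl⟩

/-- See `basisH`. -/
def basisY : sp1 := ⟨⟨0, 0, 0, 1⟩, rfl⟩

/-- The value of `u ∧ v ∧ w` under the isomorphism `Λ³ sp(1) ≅ ℝ` that sends
`X ∧ Y ∧ H = H ∧ X ∧ Y` to `1`. -/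
def triVol (u v w : sp1) : ℝ :=
  Matrix.det !![u.1.imI, u.1.imJ, u.1.imK; v.1.imI, v.1.imJ, v.1.imK; w.1.imI, w.1.imJ, w.1.imK]

/-- The exponential map `sp(1) → Sp(1)`. -/
def expSp1 (u : sp1) : Sp1 :=
  ⟨NormedSpace.exp (u : ℍ[ℝ]), by
    have h : (u : ℍ[ℝ]).re = 0 := u.2
    rw [mem_sphere_zero_iff_norm, Quaternion.norm_exp, h]
    simp⟩

/-- The model with corners of the product manifold `Sp(1)^m`. -/
abbrev modelSp1Pow (m : ℕ) := ModelWithCorners.pi (fun _ : Fin m => 𝓡 3)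

section Action

variable {d m : ℕ} {M : Type*} [TopologicalSpace M] [ChartedSpace (EuclideanSpace ℝ (Fin d)) M]
  [MulAction (Fin m → Sp1) M]

variable (d m M) in
/-- The action map `Sp(1)^m × M → M` is smooth. -/
def IsSmoothAction : Prop :=
  ContMDiff ((modelSp1Pow m).prod (𝓡 d)) (𝓡 d) ∞
    (fun x : (Fin m → Sp1) × M => x.1 • x.2)

/-- The fundamental vector field `p ↦ d/dt|₀ exp(tU) · p` of `U ∈ sp(1)^m`. The curve passes
through `p` at time `0`, so its velocity there lies in `T_p M`. -/
def fundField (d : ℕ) {m : ℕ} {M : Type*} [TopologicalSpace M]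
    [ChartedSpace (EuclideanSpace ℝ (Fin d)) M] [MulAction (Fin m → Sp1) M]
    (U : Fin m → sp1) (p : M) : TangentSpace (𝓡 d) p :=
  (mfderiv 𝓘(ℝ, ℝ) (𝓡 d) (fun t : ℝ => (fun i => expSp1 (t • U i) : Fin m → Sp1) • p) 0 :
    ℝ →L[ℝ] EuclideanSpace ℝ (Fin d)) 1

/-- The fundamental vector field of `u ∈ sp(1)` placed in the `i`-th summand of `sp(1)^m`. -/
def fundFieldAt (d : ℕ) {m : ℕ} {M : Type*} [TopologicalSpace M]
    [ChartedSpace (EuclideanSpace ℝ (Fin d)) M] [MulAction (Fin m → Sp1) M]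
    (i : Fin m) (u : sp1) (p : M) : TangentSpace (𝓡 d) p :=
  fundField d (Pi.single i u : Fin m → sp1) p

variable (m) in
/-- The smooth action of `Sp(1)^m` preserves `ψ`, and all fundamental vector fields are
Hamiltonian: the contraction of `ψ` along them is exact. -/
structure IsGeneralizedHamiltonian (ψ : Form d M 4) : Prop where
  smooth : IsSmoothAction d m M
  preserves : ∀ (a : Fin m → Sp1) (p : M) (v : Fin 4 → TangentSpace (𝓡 d) p),
    ψ (a • p) (fun k => mfderiv (𝓡 d) (𝓡 d) (fun q : M => a • q) p (v k)) = ψ p v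
  hamiltonian : ∀ U : Fin m → sp1, (ψ.contract (fundField d U)).IsExact

/-- The differential at `p` of a real-valued function. -/
def differential (d : ℕ) {M : Type*} [TopologicalSpace M]
    [ChartedSpace (EuclideanSpace ℝ (Fin d)) M] (f : M → ℝ) (p : M) :
    TangentSpace (𝓡 d) p →L[ℝ] ℝ :=
  mfderiv (𝓡 d) 𝓘(ℝ, ℝ) f p

/-- A tri-moment map, written in the coordinates of
`((Λ³ sp(1))^m)^* ≅ ℝ^m`. Every `δ ∈ (Λ³ sp(1))^m` has the form
`(U₁ ∧ V₁ ∧ W₁, …, U_m ∧ V_m ∧ W_m)`, and the contraction convention is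
`ι_{a ∧ b ∧ c} ψ (v) = ψ(v, a, b, c)`. -/
structure IsTriMomentMap (ψ : Form d M 4) (σ : M → Fin m → ℝ) : Prop where
  smooth : ContMDiff (𝓡 d) 𝓘(ℝ, Fin m → ℝ) ∞ σ
  invariant : ∀ (a : Fin m → Sp1) (p : M), σ (a • p) = σ p
  differential_eq : ∀ (p : M) (v : TangentSpace (𝓡 d) p) (U V W : Fin m → sp1),
    ∑ i, differential d (fun q => σ q i) p v * triVol (U i) (V i) (W i) =
      ∑ i, ψ p ![v, fundFieldAt d i (U i) p, fundFieldAt d i (V i) p, fundFieldAt d i (W i) p]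

/-- The set of critical points of a real-valued function. -/
def Crit (d : ℕ) {M : Type*} [TopologicalSpace M]
    [ChartedSpace (EuclideanSpace ℝ (Fin d)) M] (f : M → ℝ) : Set M :=
  {p | differential d f p = 0}

/-! ### Partitioned strongly non-degenerate forms -/

/-- Every tangent space is the direct sum of the four-dimensional subspaces `V p i`, the `i`-th of
which contains the fundamental vectors of the `i`-th factor and on each of which `ψ` restricts to
a non-degenerate form. -/
structure IsStronglyNondegenerate (ψ : Form d M 4)
    (V : ∀ p : M, Fin m → Submodule ℝ (TangentSpace (𝓡 d) p)) : Prop where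
  isInternal : ∀ p, DirectSum.IsInternal (V p)
  finrank_eq : ∀ p i, Module.finrank ℝ (V p i) = 4
  fundField_mem : ∀ p i (u : sp1), fundFieldAt d i u p ∈ V p i
  nondegenerate : ∀ p i, ∀ v ∈ V p i,
    (∀ a ∈ V p i, ∀ b ∈ V p i, ∀ c ∈ V p i, ψ p ![v, a, b, c] = 0) → v = 0

/-- The fundamental vectors `v₁ⁱ, v₂ⁱ, v₃ⁱ` of `H, X, Y` in the `i`-th factor, as elements of
`V p i`. -/
def triple {ψ : Form d M 4} {V : ∀ p : M, Fin m → Submodule ℝ (TangentSpace (𝓡 d) p)}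
    (hV : IsStronglyNondegenerate ψ V) (i : Fin m) (p : M) : Fin 3 → V p i :=
  ![⟨_, hV.fundField_mem p i basisH⟩, ⟨_, hV.fundField_mem p i basisX⟩,
    ⟨_, hV.fundField_mem p i basisY⟩]

/-- The vector `v₄ⁱ = L(v₁ⁱ ∧ v₂ⁱ ∧ v₃ⁱ)`. -/
def fourth {ψ : Form d M 4} {V : ∀ p : M, Fin m → Submodule ℝ (TangentSpace (𝓡 d) p)}
    (hV : IsStronglyNondegenerate ψ V) (L : ∀ p i, ⋀[ℝ]^3 (V p i) ≃ₗ[ℝ] V p i)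
    (i : Fin m) (p : M) : TangentSpace (𝓡 d) p :=
  (L p i (exteriorPower.ιMulti ℝ 3 (triple hV i p)) : TangentSpace (𝓡 d) p)

/-- The vectors `v₁ⁱ, v₂ⁱ, v₃ⁱ, v₄ⁱ`. -/
def frame {ψ : Form d M 4} {V : ∀ p : M, Fin m → Submodule ℝ (TangentSpace (𝓡 d) p)}
    (hV : IsStronglyNondegenerate ψ V) (L : ∀ p i, ⋀[ℝ]^3 (V p i) ≃ₗ[ℝ] V p i)
    (p : M) (x : Fin m × Fin 4) : TangentSpace (𝓡 d) p :=
  ![fundFieldAt d x.1 basisH p, fundFieldAt d x.1 basisX p, fundFieldAt d x.1 basisY p,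
    fourth hV L x.1 p] x.2

/-- The strongly non-degenerate form `ψ` is partitioned, with isomorphisms
`L : Λ³ V_i → V_i` and metric `g`: `ψ` vanishes as soon as two of its arguments lie in different
summands, `g(v, L(a ∧ b ∧ c)) = ψ(v, a, b, c)` for `a, b, c` in the same summand, and wherever the
`3m` fundamental vectors are linearly independent, the vectors `v₁ⁱ, …, v₄ⁱ` form a basis
in which `g` is diagonal. -/
structure IsPartitioned {ψ : Form d M 4}
    {V : ∀ p : M, Fin m → Submodule ℝ (TangentSpace (𝓡 d) p)}
    (hV : IsStronglyNondegenerate ψ V) (L : ∀ p i, ⋀[ℝ]^3 (V p i) ≃ₗ[ℝ] V p i)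
    (g : BilinField d M) : Prop where
  partitioned : ∀ (p : M) (w : Fin 4 → TangentSpace (𝓡 d) p) (a b : Fin 4) (i j : Fin m),
    i ≠ j → w a ∈ V p i → w b ∈ V p j → a ≠ b → ψ p w = 0
  isMetric : IsMetric g
  metric_eq : ∀ (p : M) (k : Fin m) (v : TangentSpace (𝓡 d) p) (w : Fin 3 → V p k),
    g p v (L p k (exteriorPower.ιMulti ℝ 3 w)) = ψ p ![v, w 0, w 1, w 2]
  basis : ∀ p : M,
    LinearIndependent ℝ (fun x : Fin m × Fin 3 => (triple hV x.1 p x.2 : TangentSpace (𝓡 d) p)) →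
    LinearIndependent ℝ (frame hV L p)
  diagonal : ∀ p : M,
    LinearIndependent ℝ (fun x : Fin m × Fin 3 => (triple hV x.1 p x.2 : TangentSpace (𝓡 d) p)) →
    ∀ x y : Fin m × Fin 4, x ≠ y → g p (frame hV L p x) (frame hV L p y) = 0

end Action

end Plectic

end

/-! Finiteness. At a critical point of `σ i`, the relation `g(v, v₄ⁱ) = dσᵢ(v)` and non-degeneracy
of `g` force `v₄ⁱ = 0`. Since `L` is injective, `v₁ⁱ ∧ v₂ⁱ ∧ v₃ⁱ = 0`, so some nonzero `uᵢ ∈ sp(1)`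
in the `i`-th factor has a fundamental field vanishing at the point. At a common critical point this
happens for every `i`. One-parameter subgroups of `Sp(1)` are conjugate up to speed, so some
translate of the point is fixed by the standard maximal torus `T`
(`IsPartitioned.exists_smul_fixed`). As `σ` is invariant, `A ⊆ σ(Mᵀ)`.

Conversely, the fields of `H` vanish on `Mᵀ`, so `dσ = 0` there. Near a fixed point the `T`-action
is linearized by averaging `D(-t) ∘ α t` over `T`. In the linearizing coordinates `Mᵀ` is a linear
subspace, so nearby fixed points are joined by Lipschitz paths inside `Mᵀ`, along which `σ` has zero
derivative. Thus `σ` is locally constant on the compact set `Mᵀ` and takes finitely many values on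
it (`IsLocalAction.eventually_eq_of_fixed`, `IsPartitioned.finite_image_crit`).

Convexity. Were `σ p₀` outside the hull of `A`, a linear functional would separate it strictly from
`A`. As `A` is finite, the coefficients can be perturbed to be all nonzero. A maximum of the
resulting combination on `M` is a critical point of it. Because `dσᵢ` vanishes on `V j` for `j ≠ i`,
that point is critical for every `σ i`, so its value lies in `A`, a contradiction
(`IsPartitioned.range_subset_convexHull`). -/

namespace Plectic

open MeasureTheory Filter Topology Set

/-! ### Linearization of compact group actions at a fixed point -/

section Linearization

variable {T : Type*} [AddCommGroup T] [TopologicalSpace T]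
  {E : Type*} [NormedAddCommGroup E] [NormedSpace ℝ E]

/-- A local action of a compact abelian group on a Banach space near a fixed point: the maps `α t`
have derivative `D t` at `y₀`, strictly and uniformly in `t`. -/
structure IsLocalAction (α : T → E → E) (D : T → E →L[ℝ] E) (y₀ : E) : Prop where
  fixed : ∀ t, α t y₀ = y₀
  continuous_deriv : Continuous D
  approx : ∀ ε > 0, ∀ᶠ z : E × E in 𝓝 (y₀, y₀), ∀ t,
    ‖α t z.1 - α t z.2 - D t (z.1 - z.2)‖ ≤ ε * ‖z.1 - z.2‖
  continuous_orbit : ∀ᶠ y in 𝓝 y₀, Continuous (fun t => α t y)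
  zero : ∀ᶠ y in 𝓝 y₀, α 0 y = y
  add : ∀ᶠ y in 𝓝 y₀, ∀ s t, α (s + t) y = α s (α t y)

namespace IsLocalAction

variable {α : T → E → E} {D : T → E →L[ℝ] E} {y₀ : E}

theorem hasFDerivAt (h : IsLocalAction α D y₀) (t : T) : HasFDerivAt (α t) (D t) y₀ := by
  rw [hasFDerivAt_iff_isLittleO, Asymptotics.isLittleO_iff]
  intro ε hε
  have h1 : Tendsto (fun y : E => (y, y₀)) (𝓝 y₀) (𝓝 (y₀, y₀)) :=
    (Continuous.prodMk_left y₀).tendsto y₀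
  filter_upwards [h1.eventually (h.approx ε hε)] with y hy using hy t

theorem deriv_zero (h : IsLocalAction α D y₀) : D 0 = ContinuousLinearMap.id ℝ E :=
  (h.hasFDerivAt 0).unique ((hasFDerivAt_id y₀).congr_of_eventuallyEq h.zero)

theorem deriv_add (h : IsLocalAction α D y₀) (s t : T) : D (s + t) = (D s).comp (D t) := by
  refine (h.hasFDerivAt (s + t)).unique (HasFDerivAt.congr_of_eventuallyEq
    (f := α s ∘ α t) ?_ (h.add.mono fun y hy => hy s t))
  refine HasFDerivAt.comp y₀ ?_ (h.hasFDerivAt t)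
  rw [h.fixed]
  exact h.hasFDerivAt s

theorem exists_deriv_bound [CompactSpace T] (h : IsLocalAction α D y₀) : ∃ C : ℝ, 0 < C ∧ ∀ t, ‖D t‖ ≤ C := by
  obtain ⟨C, hC⟩ := isCompact_univ.exists_bound_of_continuousOn h.continuous_deriv.continuousOn
  exact ⟨max C 1, by positivity, fun t => (hC t (mem_univ t)).trans (le_max_left _ _)⟩

/-- The average of `D t ⁻¹ ∘ α t`, which linearizes the local action. -/
noncomputable def average [MeasurableSpace T] (μ : Measure T) (α : T → E → E) (D : T → E →L[ℝ] E) (y : E) : E :=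
  ∫ t, D (-t) (α t y) ∂μ

variable [IsTopologicalAddGroup T] [CompactSpace T] [MeasurableSpace T] [BorelSpace T]
  (μ : Measure T) [IsProbabilityMeasure μ]

theorem integrable (h : IsLocalAction α D y₀) {y : E} (hy : Continuous fun t => α t y) :
    Integrable (fun t => D (-t) (α t y)) μ := by
  refine Continuous.integrable_of_hasCompactSupport ?_ (HasCompactSupport.of_compactSpace _)
  exact (h.continuous_deriv.comp continuous_neg).clm_apply hy

variable [CompleteSpace E]

/-- Substituting `t ↦ s + t` in the integral, with `D(-t) = D s ∘ D(-(s + t))`, moves the factor `D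
s` out of it. Invariance of the measure does the rest. -/
theorem average_equivariant [μ.IsAddLeftInvariant] (h : IsLocalAction α D y₀) {y : E}
    (hy : Continuous fun t => α t y) (hadd : ∀ s t, α (s + t) y = α s (α t y)) (s : T) :
    average μ α D (α s y) = D s (average μ α D y) := by
  have h1 : ∀ t, D (-t) (α t (α s y)) = (fun r => D s (D (-r) (α r y))) (s + t) := by
    intro t
    have : -t = s + -(s + t) := by abel
    simp only
    rw [← hadd, this, h.deriv_add, add_comm t s]
    simp
  unfold average
  simp_rw [h1]
  rw [integral_add_left_eq_self (μ := μ) (fun r => D s (D (-r) (α r y))) s]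
  exact ContinuousLinearMap.integral_comp_comm _ (h.integrable μ hy)

/-- The average is strictly differentiable at `y₀` with derivative the identity, because each `D(-t)
∘ α t` is so, uniformly in `t`. Only strict differentiability is available, so the inverse function
argument below uses this estimate directly. -/
theorem average_approx (h : IsLocalAction α D y₀) {ε : ℝ} (hε : 0 < ε) :
    ∀ᶠ z : E × E in 𝓝 (y₀, y₀),
      ‖average μ α D z.1 - average μ α D z.2 - (z.1 - z.2)‖ ≤ ε * ‖z.1 - z.2‖ := by
  obtain ⟨C, hC, hDC⟩ := h.exists_deriv_bound
  have hc1 : ∀ᶠ z : E × E in 𝓝 (y₀, y₀), Continuous fun t => α t z.1 :=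
    (continuous_fst.tendsto (y₀, y₀)).eventually h.continuous_orbit
  have hc2 : ∀ᶠ z : E × E in 𝓝 (y₀, y₀), Continuous fun t => α t z.2 :=
    (continuous_snd.tendsto (y₀, y₀)).eventually h.continuous_orbit
  filter_upwards [hc1, hc2, h.approx (ε / C) (by positivity)] with z h1 h2 h3
  have key : ∀ t, D (-t) (α t z.1) - D (-t) (α t z.2) - (z.1 - z.2) =
      D (-t) (α t z.1 - α t z.2 - D t (z.1 - z.2)) := by
    intro t
    have : D (-t) (D t (z.1 - z.2)) = z.1 - z.2 := by
      have := congrArg (fun A => A (z.1 - z.2)) (h.deriv_add (-t) t)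
      simpa [h.deriv_zero] using this.symm
    rw [map_sub (D (-t)) (α t z.1 - α t z.2), this, map_sub (D (-t)) (α t z.1)]
  have e1 : average μ α D z.1 - average μ α D z.2 - (z.1 - z.2) =
      ∫ t, D (-t) (α t z.1 - α t z.2 - D t (z.1 - z.2)) ∂μ := by
    simp_rw [← key]
    rw [integral_sub (f := fun t => D (-t) (α t z.1) - D (-t) (α t z.2))
        ((h.integrable μ h1).sub (h.integrable μ h2)) (integrable_const _),
      integral_sub (h.integrable μ h1) (h.integrable μ h2)]
    simp [average]
  rw [e1]
  refine (norm_integral_le_of_norm_le_const (μ := μ) (C := ε * ‖z.1 - z.2‖) ?_).trans (by simp)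
  refine Eventually.of_forall fun t => ?_
  calc _ ≤ ‖D (-t)‖ * ‖α t z.1 - α t z.2 - D t (z.1 - z.2)‖ := (D (-t)).le_opNorm _
    _ ≤ C * (ε / C * ‖z.1 - z.2‖) := by gcongr; exacts [hDC _, h3 t]
    _ = ε * ‖z.1 - z.2‖ := by field_simp

/-- Fixed points near `y₀` can be joined to `y₀` by a Lipschitz path of fixed points. -/
theorem exists_lipschitz_path [μ.IsAddLeftInvariant] (h : IsLocalAction α D y₀) {W : Set E}
    (hW : W ∈ 𝓝 y₀) :
    ∀ᶠ y in 𝓝 y₀, (∀ t, α t y = y) → ∃ (γ : ℝ → E) (K : ℝ), γ 0 = y₀ ∧ γ 1 = y ∧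
      (∀ a ∈ Icc (0 : ℝ) 1, ∀ b ∈ Icc (0 : ℝ) 1, ‖γ a - γ b‖ ≤ K * |a - b|) ∧
      ∀ a ∈ Icc (0 : ℝ) 1, γ a ∈ W ∧ ∀ t, α t (γ a) = γ a := by
  obtain ⟨C, hC, hDC⟩ := h.exists_deriv_bound
  set Ψ := average μ α D with hΨ
  have happ := (h.average_approx μ (ε := 1 / 2) (by norm_num)).and (h.approx 1 one_pos)
  rw [Metric.eventually_nhds_iff] at happ
  obtain ⟨r, hr, happ⟩ := happ
  have happ' : ∀ a ∈ Metric.ball y₀ r, ∀ b ∈ Metric.ball y₀ r, _ := fun a ha b hb =>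
    happ (y := (a, b)) (max_lt ha hb)
  have hanti : ∀ a ∈ Metric.ball y₀ r, ∀ b ∈ Metric.ball y₀ r, ‖a - b‖ ≤ 2 * ‖Ψ a - Ψ b‖ := by
    intro a ha b hb
    have h1 := (happ' a ha b hb).1
    have h2 := norm_sub_norm_le (a - b) (Ψ a - Ψ b)
    rw [norm_sub_rev (a - b)] at h2
    simp only at h1
    linarith
  have hexp : ∀ a ∈ Metric.ball y₀ r, ∀ t, ‖α t a - y₀‖ ≤ (C + 1) * ‖a - y₀‖ := by
    intro a ha t
    have h1 := (happ' a ha y₀ (Metric.mem_ball_self hr)).2 t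
    simp only [h.fixed] at h1
    have h2 := norm_sub_norm_le (α t a - y₀) (D t (a - y₀))
    have h3 := ((D t).le_opNorm (a - y₀)).trans
      (mul_le_mul_of_nonneg_right (hDC t) (norm_nonneg _))
    linarith
  have hgood := (h.continuous_orbit.and h.add).and hW
  rw [Metric.eventually_nhds_iff] at hgood
  obtain ⟨r₁, hr₁, hgood⟩ := hgood
  set B := Metric.ball y₀ (min r₁ (r / (C + 1))) with hB
  have hr₂ : 0 < min r₁ (r / (C + 1)) := by positivity
  have hBr : B ⊆ Metric.ball y₀ r :=
    Metric.ball_subset_ball ((min_le_right _ _).trans (div_le_self hr.le (by linarith)))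
  -- If `Ψ a` is fixed by the linear action, then `Ψ (α t a) = D t (Ψ a) = Ψ a`, and injectivity of
  -- `Ψ` gives `α t a = a`.
  have hfixB : ∀ a ∈ B, (∀ t, D t (Ψ a) = Ψ a) → ∀ t, α t a = a := by
    intro a ha hDa t
    have ha1 := hgood (lt_of_lt_of_le (Metric.mem_ball.1 ha) (min_le_left _ _))
    have hαa : α t a ∈ Metric.ball y₀ r := by
      rw [mem_ball_iff_norm]
      refine (hexp a (hBr ha) t).trans_lt ?_
      have : ‖a - y₀‖ < r / (C + 1) :=
        (mem_ball_iff_norm.1 ha).trans_le (min_le_right _ _)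
      rw [lt_div_iff₀ (by linarith)] at this
      linarith
    have h1 := hanti _ hαa _ (hBr ha)
    rw [hΨ, h.average_equivariant μ ha1.1.1 ha1.1.2, ← hΨ, hDa, sub_self, norm_zero,
      mul_zero] at h1
    exact sub_eq_zero.1 (norm_le_zero_iff.1 h1)
  have happB : ApproximatesLinearOn Ψ ((ContinuousLinearEquiv.refl ℝ E : E ≃L[ℝ] E) : E →L[ℝ] E)
      B (1 / 2) := by
    intro a ha b hb
    simpa using (happ' a (hBr ha) b (hBr hb)).1
  -- A map within `1/2` of the identity is open at `y₀`, since `1/2` is below the inverse norm of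
  -- the identity.
  have himg : Ψ '' B ∈ 𝓝 (Ψ y₀) := by
    refine happB.image_mem_nhds (ContinuousLinearEquiv.refl ℝ E).toNonlinearRightInverse
      (Metric.ball_mem_nhds _ hr₂) ?_
    rcases subsingleton_or_nontrivial E with hE | hE
    · exact Or.inl hE
    · right
      have : (ContinuousLinearEquiv.refl ℝ E).toNonlinearRightInverse.nnnorm = 1 := by
        change ‖(((ContinuousLinearEquiv.refl ℝ E).symm : E ≃L[ℝ] E) : E →L[ℝ] E)‖₊ = 1
        have : (((ContinuousLinearEquiv.refl ℝ E).symm : E ≃L[ℝ] E) : E →L[ℝ] E) =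
          ContinuousLinearMap.id ℝ E := rfl
        rw [this, ← NNReal.coe_inj, coe_nnnorm, ContinuousLinearMap.norm_id, NNReal.coe_one]
      rw [this]
      norm_num
  obtain ⟨δ, hδ, hball⟩ := Metric.mem_nhds_iff.1 himg
  have hcont : ContinuousAt Ψ y₀ :=
    happB.continuousOn.continuousAt (Metric.ball_mem_nhds _ hr₂)
  filter_upwards [Metric.ball_mem_nhds y₀ hr₂, hcont (Metric.ball_mem_nhds _ hδ)] with y hyB hyδ hy
  -- The path is the preimage under `Ψ` of the segment from `Ψ y₀` to `Ψ y`. Its endpoints are fixed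
  -- by the linear maps `D t`, hence so is every point of the segment.
  have hw : ∀ a ∈ Icc (0 : ℝ) 1, ∃ x ∈ B, Ψ x = Ψ y₀ + a • (Ψ y - Ψ y₀) := by
    intro a ha
    refine hball ?_
    rw [mem_ball_iff_norm, add_sub_cancel_left, norm_smul, Real.norm_of_nonneg ha.1]
    calc _ ≤ 1 * ‖Ψ y - Ψ y₀‖ := by gcongr; exact ha.2
      _ < δ := by rw [one_mul]; exact mem_ball_iff_norm.1 hyδ
  choose! γ hγB hγ using hw
  have hy₀B : y₀ ∈ B := Metric.mem_ball_self hr₂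
  have hinj : ∀ a ∈ B, ∀ b ∈ B, Ψ a = Ψ b → a = b := by
    intro a ha b hb hab
    have := hanti a (hBr ha) b (hBr hb)
    rw [hab, sub_self, norm_zero, mul_zero] at this
    exact sub_eq_zero.1 (norm_le_zero_iff.1 this)
  have hDfix : ∀ a ∈ B, (∀ t, α t a = a) → ∀ t, D t (Ψ a) = Ψ a := by
    intro a ha hfa t
    have ha1 := hgood (lt_of_lt_of_le (Metric.mem_ball.1 ha) (min_le_left _ _))
    rw [hΨ, ← h.average_equivariant μ ha1.1.1 ha1.1.2, hfa]
  have m0 : (0 : ℝ) ∈ Icc (0 : ℝ) 1 := by simp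
  have m1 : (1 : ℝ) ∈ Icc (0 : ℝ) 1 := by simp
  refine ⟨γ, 2 * ‖Ψ y - Ψ y₀‖, ?_, ?_, ?_, ?_⟩
  · exact hinj _ (hγB 0 m0) _ hy₀B (by rw [hγ 0 m0]; simp)
  · exact hinj _ (hγB 1 m1) _ hyB (by rw [hγ 1 m1]; simp)
  · intro a ha b hb
    refine (hanti _ (hBr (hγB a ha)) _ (hBr (hγB b hb))).trans (le_of_eq ?_)
    rw [hγ a ha, hγ b hb, add_sub_add_left_eq_sub, ← sub_smul, norm_smul, Real.norm_eq_abs]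
    ring
  · intro a ha
    refine ⟨(hgood (lt_of_lt_of_le (Metric.mem_ball.1 (hγB a ha)) (min_le_left _ _))).2,
      hfixB _ (hγB a ha) fun t => ?_⟩
    rw [hγ a ha, map_add, map_smul, map_sub, hDfix y hyB hy, hDfix y₀ hy₀B h.fixed]

/-- A function which is critical at all fixed points near `y₀` is locally constant on them. -/
theorem eventually_eq_of_fixed [μ.IsAddLeftInvariant] (h : IsLocalAction α D y₀) {W : Set E}
    (hW : W ∈ 𝓝 y₀) {F : Type*} [NormedAddCommGroup F] [NormedSpace ℝ F] {f : E → F}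
    (hf : ∀ y ∈ W, (∀ t, α t y = y) → HasFDerivAt f (0 : E →L[ℝ] F) y) :
    ∀ᶠ y in 𝓝 y₀, (∀ t, α t y = y) → f y = f y₀ := by
  filter_upwards [h.exists_lipschitz_path μ hW] with y hy hfix
  obtain ⟨γ, K, h0, h1, hlip, hγ⟩ := hy hfix
  -- `γ` need not be differentiable: `f (γ b) - f (γ a) = o(γ b - γ a)` and `γ b - γ a = O(b - a)`
  -- already give derivative zero.
  have hder : ∀ a ∈ Icc (0 : ℝ) 1, HasDerivWithinAt (f ∘ γ) 0 (Icc 0 1) a := by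
    intro a ha
    have hO : (fun b => γ b - γ a) =O[𝓝[Icc 0 1] a] (fun b => b - a) := by
      refine Asymptotics.IsBigO.of_bound K ?_
      filter_upwards [self_mem_nhdsWithin] with b hb
      exact hlip b hb a ha
    have hcont : Tendsto γ (𝓝[Icc 0 1] a) (𝓝 (γ a)) := by
      have : Tendsto (fun b : ℝ => b - a) (𝓝[Icc 0 1] a) (𝓝 0) := by
        have : ContinuousWithinAt (fun b : ℝ => b - a) (Icc 0 1) a := by fun_prop
        simpa [ContinuousWithinAt] using this
      simpa using (hO.trans_tendsto this).add_const (γ a)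
    have hfa := (hf _ (hγ a ha).1 (hγ a ha).2).isLittleO
    rw [hasDerivWithinAt_iff_isLittleO]
    simpa [Function.comp_def] using (hfa.comp_tendsto hcont).trans_isBigO hO
  have := (convex_Icc (0 : ℝ) 1).norm_image_sub_le_of_norm_hasDerivWithin_le (C := 0) hder
    (by simp) (show (0 : ℝ) ∈ Icc (0 : ℝ) 1 by simp) (show (1 : ℝ) ∈ Icc (0 : ℝ) 1 by simp)
  simp only [Function.comp_apply, h0, h1, zero_mul] at this
  exact sub_eq_zero.1 (norm_le_zero_iff.1 this)

end IsLocalAction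

end Linearization

/-! ### The exponential map of `Sp(1)^m` and conjugacy of one-parameter subgroups -/

section Exponential

theorem contMDiff_pi_sphere {m : ℕ} {F : Type*} [NormedAddCommGroup F] [NormedSpace ℝ F]
    {f : F → Fin m → Sp1} (hf : ∀ i, ContMDiff 𝓘(ℝ, F) (𝓡 3) ∞ fun x => f x i) :
    ContMDiff 𝓘(ℝ, F) (modelSp1Pow m) ∞ f := by
  intro x
  rw [contMDiffAt_iff_target]
  refine ⟨continuousAt_pi.2 fun i => (hf i x).continuousAt, ?_⟩
  rw [contMDiffAt_pi_space]
  exact fun i => (contMDiffAt_iff_target.1 (hf i x)).2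

theorem contMDiff_expSp1 : ContMDiff 𝓘(ℝ, sp1) (𝓡 3) ∞ expSp1 := by
  have h : ContMDiff 𝓘(ℝ, sp1) 𝓘(ℝ, ℍ[ℝ]) ∞ (fun u : sp1 => NormedSpace.exp (u : ℍ[ℝ])) := by
    refine ContDiff.contMDiff (ContDiff.comp ?_ sp1.subtypeL.contDiff)
    exact contDiff_iff_contDiffAt.2 fun x => (NormedSpace.exp_analytic (𝕂 := ℝ) x).contDiffAt
  exact h.codRestrict_sphere fun u => (expSp1 u).2

variable {m : ℕ}

/-- The exponential map `sp(1)^m → Sp(1)^m`. -/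
noncomputable def expPow (U : Fin m → sp1) : Fin m → Sp1 := fun i => expSp1 (U i)

theorem contMDiff_expPow :
    ContMDiff 𝓘(ℝ, Fin m → sp1) (modelSp1Pow m) ∞ (expPow : (Fin m → sp1) → Fin m → Sp1) :=
  contMDiff_pi_sphere fun i => contMDiff_expSp1.comp
    (ContinuousLinearMap.proj (R := ℝ) (φ := fun _ : Fin m => sp1) i).contDiff.contMDiff

@[simp] theorem basisH_re : (basisH : ℍ[ℝ]).re = 0 := rfl

@[simp] theorem basisH_imI : (basisH : ℍ[ℝ]).imI = 1 := rfl

@[simp] theorem basisH_imJ : (basisH : ℍ[ℝ]).imJ = 0 := rfl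

@[simp] theorem basisH_imK : (basisH : ℍ[ℝ]).imK = 0 := rfl

@[simp] theorem basisX_imI : (basisX : ℍ[ℝ]).imI = 0 := rfl

@[simp] theorem basisX_imJ : (basisX : ℍ[ℝ]).imJ = 1 := rfl

@[simp] theorem basisX_imK : (basisX : ℍ[ℝ]).imK = 0 := rfl

@[simp] theorem basisY_imI : (basisY : ℍ[ℝ]).imI = 0 := rfl

@[simp] theorem basisY_imJ : (basisY : ℍ[ℝ]).imJ = 0 := rfl

@[simp] theorem basisY_imK : (basisY : ℍ[ℝ]).imK = 1 := rfl

theorem expSp1_add_smul (u : sp1) (s t : ℝ) :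
    expSp1 ((s + t) • u) = expSp1 (s • u) * expSp1 (t • u) := by
  apply Subtype.ext
  change NormedSpace.exp (((s + t) • u : sp1) : ℍ[ℝ]) =
    NormedSpace.exp ((s • u : sp1) : ℍ[ℝ]) * NormedSpace.exp ((t • u : sp1) : ℍ[ℝ])
  let _ := NormedAlgebra.restrictScalars ℚ ℝ ℍ[ℝ]
  rw [← NormedSpace.exp_add_of_commute]
  · simp [add_smul]
  · simpa using ((Commute.refl (u : ℍ[ℝ])).smul_left s).smul_right t

theorem expSp1_zero : expSp1 0 = 1 := Subtype.ext NormedSpace.exp_zero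

theorem expPow_zero : expPow (0 : Fin m → sp1) = 1 := funext fun _ => expSp1_zero

theorem expPow_add_smul (U : Fin m → sp1) (s t : ℝ) :
    expPow ((s + t) • U) = expPow (s • U) * expPow (t • U) :=
  funext fun i => expSp1_add_smul (U i) s t

/-- Every one-parameter subgroup of `Sp(1)` is conjugate to that of `H`, up to its speed. -/
theorem exists_conj_basisH {u : sp1} (hu : u ≠ 0) :
    ∃ (a : Sp1) (c : ℝ), ∀ t : ℝ, expSp1 (t • basisH) = a * expSp1 (t • c • u) * a⁻¹ := by
  have hre : (u : ℍ[ℝ]).re = 0 := u.2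
  have hu' : (u : ℍ[ℝ]) ≠ 0 := fun h => hu (Subtype.ext h)
  have hn : ‖(u : ℍ[ℝ])‖ ≠ 0 := norm_ne_zero_iff.2 hu'
  set q : ℍ[ℝ] := ‖(u : ℍ[ℝ])‖⁻¹ • (u : ℍ[ℝ]) with hq
  have hqre : q.re = 0 := by simp [hq, hre]
  have hqn : Quaternion.normSq q = 1 := by
    rw [Quaternion.normSq_eq_norm_mul_self, hq, norm_smul]
    simp [hn]
  rw [Quaternion.normSq_def'] at hqn
  -- With `i² = q² = -1`, the element `b = i + q` satisfies `i b = -1 + i q = b q`. It vanishes only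
  -- for `q = -i`, where `b = j` works because `j` anticommutes with `i`.
  obtain ⟨b, hb, hbq⟩ : ∃ b : ℍ[ℝ], b ≠ 0 ∧ (basisH : ℍ[ℝ]) * b = b * q := by
    by_cases h : (basisH : ℍ[ℝ]) + q = 0
    · obtain ⟨j, h0, h1, h2, h3⟩ :
          ∃ j : ℍ[ℝ], j.re = 0 ∧ j.imI = 0 ∧ j.imJ = 1 ∧ j.imK = 0 :=
        ⟨⟨0, 0, 1, 0⟩, rfl, rfl, rfl, rfl⟩
      refine ⟨j, fun h => by simp [h] at h2, ?_⟩
      rw [← neg_eq_of_add_eq_zero_right h]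
      ext <;> simp [h0, h1, h2, h3]
    · refine ⟨_, h, ?_⟩
      ext <;> simp [hqre]
      · nlinarith [hqn, hqre]
      all_goals ring
  have hbn : ‖b‖ ≠ 0 := norm_ne_zero_iff.2 hb
  refine ⟨⟨‖b‖⁻¹ • b, by simp [norm_smul, hbn]⟩, ‖(u : ℍ[ℝ])‖⁻¹, fun t => Subtype.ext ?_⟩
  change NormedSpace.exp (t • (basisH : ℍ[ℝ])) =
    (‖b‖⁻¹ • b) * NormedSpace.exp (t • q) * (‖b‖⁻¹ • b)⁻¹
  let _ := NormedAlgebra.restrictScalars ℚ ℝ ℍ[ℝ]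
  rw [← NormedSpace.exp_conj _ _ (smul_ne_zero (inv_ne_zero hbn) hb)]
  congr 1
  rw [eq_mul_inv_iff_mul_eq₀ (smul_ne_zero (inv_ne_zero hbn) hb)]
  simp only [smul_mul_assoc, mul_smul_comm, hbq]
  rw [smul_comm]

theorem expSp1_two_pi : expSp1 ((2 * Real.pi) • basisH) = 1 := by
  apply Subtype.ext
  change NormedSpace.exp ((2 * Real.pi) • (basisH : ℍ[ℝ])) = 1
  have hn : ‖(basisH : ℍ[ℝ])‖ = 1 := by
    have : Quaternion.normSq (basisH : ℍ[ℝ]) = 1 := by simp [Quaternion.normSq_def']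
    rw [Quaternion.normSq_eq_norm_mul_self] at this
    nlinarith [norm_nonneg (basisH : ℍ[ℝ])]
  rw [Quaternion.exp_of_re_eq_zero _ (by simp), norm_smul, hn, mul_one,
    Real.norm_of_nonneg Real.two_pi_pos.le]
  simp

end Exponential

/-! ### Orbits, fundamental fields and stabilizers -/

section Orbits

variable {d m : ℕ} {M : Type*} [TopologicalSpace M] [ChartedSpace (EuclideanSpace ℝ (Fin d)) M]
  [MulAction (Fin m → Sp1) M]

theorem IsSmoothAction.contMDiff_exp_smul (h : IsSmoothAction d m M) :
    ContMDiff (𝓘(ℝ, Fin m → sp1).prod (𝓡 d)) (𝓡 d) ∞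
      (fun x : (Fin m → sp1) × M => expPow x.1 • x.2) :=
  ContMDiff.comp h ((contMDiff_expPow.comp contMDiff_fst).prodMk contMDiff_snd)

theorem IsSmoothAction.contMDiff_orbit (h : IsSmoothAction d m M) (p : M) :
    ContMDiff 𝓘(ℝ, Fin m → sp1) (𝓡 d) ∞ (fun U : Fin m → sp1 => expPow U • p) :=
  h.contMDiff_exp_smul.comp (contMDiff_id.prodMk contMDiff_const)

theorem IsSmoothAction.contMDiff_smul (h : IsSmoothAction d m M) (a : Fin m → Sp1) :
    ContMDiff (𝓡 d) (𝓡 d) ∞ (fun p : M => a • p) :=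
  ContMDiff.comp (g := fun x : (Fin m → Sp1) × M => x.1 • x.2) (f := fun p : M => (a, p)) h
    (contMDiff_const.prodMk contMDiff_id)

/-- The infinitesimal action at `p` as a linear map. -/
noncomputable def infinitesimal (d : ℕ) {m : ℕ} {M : Type*} [TopologicalSpace M]
    [ChartedSpace (EuclideanSpace ℝ (Fin d)) M] [MulAction (Fin m → Sp1) M] (p : M) :
    (Fin m → sp1) →L[ℝ] EuclideanSpace ℝ (Fin d) :=
  mfderiv 𝓘(ℝ, Fin m → sp1) (𝓡 d) (fun U : Fin m → sp1 => expPow U • p) 0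

theorem IsSmoothAction.hasMFDerivAt_curve (h : IsSmoothAction d m M) (U : Fin m → sp1) (p : M) :
    HasMFDerivAt 𝓘(ℝ, ℝ) (𝓡 d) (fun t : ℝ => expPow (t • U) • p) 0
      ((infinitesimal d p).comp ((1 : ℝ →L[ℝ] ℝ).smulRight U)) := by
  have h1 : HasMFDerivAt 𝓘(ℝ, ℝ) 𝓘(ℝ, Fin m → sp1) (fun t : ℝ => t • U) 0
      ((1 : ℝ →L[ℝ] ℝ).smulRight U) :=
    ((1 : ℝ →L[ℝ] ℝ).smulRight U).hasMFDerivAt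
  have h2 : HasMFDerivAt 𝓘(ℝ, Fin m → sp1) (𝓡 d) (fun U : Fin m → sp1 => expPow U • p)
      ((0 : ℝ) • U) (infinitesimal d p) := by
    rw [zero_smul]
    exact ((h.contMDiff_orbit p).mdifferentiable (by simp) 0).hasMFDerivAt
  exact h2.comp (0 : ℝ) h1

theorem IsSmoothAction.fundField_eq (h : IsSmoothAction d m M) (U : Fin m → sp1) (p : M) :
    fundField d U p = infinitesimal d p U := by
  have := (h.hasMFDerivAt_curve U p).mfderiv
  have h2 := congrArg (fun A : ℝ →L[ℝ] EuclideanSpace ℝ (Fin d) => A 1) this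
  refine h2.trans ?_
  change infinitesimal d p ((1 : ℝ) • U) = _
  rw [one_smul]

theorem IsSmoothAction.fundFieldAt_eq (h : IsSmoothAction d m M) (i : Fin m) (u : sp1) (p : M) :
    fundFieldAt d i u p = infinitesimal d p (Pi.single i u) :=
  h.fundField_eq _ p

/-- A curve in a manifold with vanishing velocity is constant. -/
theorem eq_of_hasMFDerivAt_zero {γ : ℝ → M}
    (hγ : ∀ t, HasMFDerivAt 𝓘(ℝ, ℝ) (𝓡 d) γ t (0 : ℝ →L[ℝ] EuclideanSpace ℝ (Fin d)))
    [IsManifold (𝓡 d) ∞ M] (s t : ℝ) : γ s = γ t := by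
  have hc : Continuous γ := continuous_iff_continuousAt.2 fun t => (hγ t).continuousAt
  have hloc : IsLocallyConstant γ := by
    rw [IsLocallyConstant.iff_eventually_eq]
    intro t₀
    set e := extChartAt (𝓡 d) (γ t₀) with he
    have hsrc : ∀ᶠ t in 𝓝 t₀, γ t ∈ e.source :=
      hc.continuousAt (extChartAt_source_mem_nhds (I := 𝓡 d) (γ t₀))
    obtain ⟨r, hr, hball⟩ := Metric.eventually_nhds_iff_ball.1 hsrc
    have hder : ∀ t ∈ Metric.ball t₀ r,
        HasFDerivWithinAt (e ∘ γ) (0 : ℝ →L[ℝ] EuclideanSpace ℝ (Fin d)) (Metric.ball t₀ r) t := by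
      intro t ht
      have h1 : MDifferentiableAt (𝓡 d) 𝓘(ℝ, EuclideanSpace ℝ (Fin d)) e (γ t) :=
        mdifferentiableAt_extChartAt (by simpa [he] using hball t ht)
      have h2 := h1.hasMFDerivAt.comp t (hγ t)
      have h3 := h2.hasFDerivAt
      refine HasFDerivAt.hasFDerivWithinAt ?_
      refine h3.congr_fderiv (ContinuousLinearMap.ext fun x => ?_)
      exact map_zero (mfderiv (𝓡 d) 𝓘(ℝ, EuclideanSpace ℝ (Fin d)) e (γ t))
    filter_upwards [Metric.ball_mem_nhds t₀ hr] with t ht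
    have := (convex_ball t₀ r).norm_image_sub_le_of_norm_hasFDerivWithin_le (C := 0) hder
      (by simp) (Metric.mem_ball_self hr) ht
    rw [zero_mul, norm_le_zero_iff, sub_eq_zero] at this
    exact e.injOn (hball t ht) (hball t₀ (Metric.mem_ball_self hr)) this
  exact hloc.apply_eq_of_isPreconnected isPreconnected_univ (mem_univ s) (mem_univ t)

/-- Points where a fundamental field vanishes are fixed by the one-parameter subgroup. -/
theorem IsSmoothAction.exp_smul_eq_self [IsManifold (𝓡 d) ∞ M] (h : IsSmoothAction d m M)
    {U : Fin m → sp1} {p : M} (hU : infinitesimal d p U = 0) (t : ℝ) :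
    expPow (t • U) • p = p := by
  have hder : ∀ t, HasMFDerivAt 𝓘(ℝ, ℝ) (𝓡 d) (fun t : ℝ => expPow (t • U) • p) t
      (0 : ℝ →L[ℝ] EuclideanSpace ℝ (Fin d)) := by
    intro t
    have h0 : HasMFDerivAt 𝓘(ℝ, ℝ) (𝓡 d) (fun s : ℝ => expPow (s • U) • p) (t - t)
        (0 : ℝ →L[ℝ] EuclideanSpace ℝ (Fin d)) := by
      rw [sub_self]
      refine (h.hasMFDerivAt_curve U p).congr_mfderiv (ContinuousLinearMap.ext fun x => ?_)
      have hx : ∀ x : ℝ, infinitesimal d p (x • U) = 0 := fun x => by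
        rw [map_smul, hU, smul_zero]
      exact hx x
    have h1 : HasMFDerivAt 𝓘(ℝ, ℝ) 𝓘(ℝ, ℝ) (fun s : ℝ => s - t) t (1 : ℝ →L[ℝ] ℝ) :=
      ((hasFDerivAt_id t).sub_const t).hasMFDerivAt
    have h2 := ((h.contMDiff_smul (expPow (t • U))).mdifferentiable (by simp)
      (expPow ((t - t) • U) • p)).hasMFDerivAt.comp t
        (HasMFDerivAt.comp (f := fun s : ℝ => s - t) t h0 h1)
    -- The group law carries the velocity at time `t` back to the velocity at time `0`, which is
    -- zero.
    have h3 : (fun t : ℝ => expPow (t • U) • p) =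
        (fun q : M => expPow (t • U) • q) ∘ (fun s : ℝ => expPow (s • U) • p) ∘ (· - t) := by
      funext s
      simp only [Function.comp_apply]
      have hst : expPow (s • U) = expPow (t • U) * expPow ((s - t) • U) := by
        rw [← expPow_add_smul, add_sub_cancel]
      rw [hst]
      exact mul_smul (expPow (t • U)) (expPow ((s - t) • U)) p
    rw [h3]
    refine h2.congr_mfderiv (ContinuousLinearMap.ext fun x => ?_)
    exact map_zero (mfderiv (𝓡 d) (𝓡 d) (fun q : M => expPow (t • U) • q)
      (expPow ((t - t) • U) • p))
  have := eq_of_hasMFDerivAt_zero hder t 0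
  simpa [expPow_zero] using this

end Orbits

/-! ### The standard maximal torus and its covering by `ℝ^m` -/

section Torus

/-- The homomorphism `ℝ/ℤ → Sp(1)`, `θ ↦ exp(2πθH)`. -/
noncomputable def circleSp1 : UnitAddCircle → Sp1 :=
  Function.Periodic.lift (f := fun θ : ℝ => expSp1 (((2 * Real.pi) * θ) • basisH)) (c := 1) <| by
    intro θ
    simp only
    rw [mul_add, expSp1_add_smul, mul_one, expSp1_two_pi]
    exact mul_one _

theorem circleSp1_coe (θ : ℝ) :
    circleSp1 (θ : UnitAddCircle) = expSp1 (((2 * Real.pi) * θ) • basisH) := rfl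

theorem circleSp1_zero : circleSp1 0 = 1 := by
  have := circleSp1_coe 0
  rwa [mul_zero, zero_smul, expSp1_zero] at this

theorem circleSp1_add (s t : UnitAddCircle) : circleSp1 (s + t) = circleSp1 s * circleSp1 t := by
  induction s using QuotientAddGroup.induction_on with | _ a => ?_
  induction t using QuotientAddGroup.induction_on with | _ b => ?_
  have := circleSp1_coe (a + b)
  rw [mul_add, expSp1_add_smul] at this
  exact this

theorem continuous_circleSp1 : Continuous circleSp1 := by
  refine (QuotientAddGroup.isOpenQuotientMap_mk.isQuotientMap.continuous_iff).2 ?_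
  exact contMDiff_expSp1.continuous.comp (by fun_prop)

variable {m : ℕ}

/-- The standard maximal torus of `Sp(1)^m`. -/
noncomputable def torus (t : UnitAddTorus (Fin m)) : Fin m → Sp1 := fun i => circleSp1 (t i)

/-- The covering `ℝ^m → (ℝ/ℤ)^m`. -/
noncomputable def torusMk (θ : Fin m → ℝ) : UnitAddTorus (Fin m) := fun i => (θ i : UnitAddCircle)

/-- The element of `sp(1)^m` with exponential `torus (torusMk θ)`. -/
noncomputable def torusLog : (Fin m → ℝ) →L[ℝ] (Fin m → sp1) :=
  ContinuousLinearMap.pi fun i =>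
    ((2 * Real.pi) • ContinuousLinearMap.proj (R := ℝ) (φ := fun _ : Fin m => ℝ) i).smulRight basisH

theorem torus_torusMk (θ : Fin m → ℝ) : torus (torusMk θ) = expPow (torusLog θ) := rfl

theorem isOpenQuotientMap_torusMk :
    IsOpenQuotientMap (torusMk : (Fin m → ℝ) → UnitAddTorus (Fin m)) :=
  IsOpenQuotientMap.piMap (f := fun (_ : Fin m) (x : ℝ) => (x : UnitAddCircle))
    fun _ => QuotientAddGroup.isOpenQuotientMap_mk

theorem exists_mem_Icc_torusMk (t : UnitAddTorus (Fin m)) :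
    ∃ θ ∈ Icc (0 : Fin m → ℝ) 1, torusMk θ = t := by
  have h : ∀ i, ∃ x ∈ Ico (0 : ℝ) 1, (x : UnitAddCircle) = t i := fun i => by
    have h := mem_univ (t i)
    rw [← AddCircle.coe_image_Ico_eq (1 : ℝ) 0, zero_add] at h
    exact h
  choose θ hθ h using h
  exact ⟨θ, ⟨fun i => (hθ i).1, fun i => (hθ i).2.le⟩, funext h⟩

theorem continuous_torus : Continuous (torus : UnitAddTorus (Fin m) → Fin m → Sp1) :=
  continuous_pi fun i => continuous_circleSp1.comp (continuous_apply i)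

theorem torus_zero : torus (0 : UnitAddTorus (Fin m)) = 1 := funext fun _ => circleSp1_zero

theorem torus_add (s t : UnitAddTorus (Fin m)) : torus (s + t) = torus s * torus t :=
  funext fun i => circleSp1_add (s i) (t i)

instance isProbabilityMeasure_torus :
    IsProbabilityMeasure (volume : Measure (UnitAddTorus (Fin m))) := by
  have : IsProbabilityMeasure (volume : Measure UnitAddCircle) := ⟨by simp⟩
  exact inferInstanceAs (IsProbabilityMeasure (Measure.pi fun _ : Fin m =>
    (volume : Measure UnitAddCircle)))

end Torus

/-! ### Strict differentiability, uniform in a parameter -/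

section Uniform

variable {P E F : Type*} [NormedAddCommGroup P] [NormedSpace ℝ P] [NormedAddCommGroup E]
  [NormedSpace ℝ E] [NormedAddCommGroup F] [NormedSpace ℝ F]

/-- The partial derivative of a smooth function in the second variable approximates it strictly and
locally uniformly in the first one. -/
theorem eventually_approx_of_contDiffAt {β : P × E → F} {θ : P} {y₀ : E}
    (h : ContDiffAt ℝ ∞ β (θ, y₀)) {ε : ℝ} (hε : 0 < ε) :
    ∀ᶠ x : (E × E) × P in 𝓝 ((y₀, y₀), θ),
      ‖β (x.2, x.1.1) - β (x.2, x.1.2) -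
        ((fderiv ℝ β (x.2, y₀)).comp (ContinuousLinearMap.inr ℝ P E)) (x.1.1 - x.1.2)‖ ≤
        ε * ‖x.1.1 - x.1.2‖ := by
  -- Half of `ε` pays for strict differentiability at `(θ, y₀)`, the other half for moving the
  -- derivative from `(θ, y₀)` to `(x.2, y₀)`.
  have hs := (h.hasStrictFDerivAt (by simp)).isLittleO.def (half_pos hε)
  have ht : Tendsto (fun x : (E × E) × P => ((x.2, x.1.1), (x.2, x.1.2))) (𝓝 ((y₀, y₀), θ))
      (𝓝 ((θ, y₀), (θ, y₀))) := by
    have : Continuous (fun x : (E × E) × P => ((x.2, x.1.1), (x.2, x.1.2))) := by fun_prop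
    exact this.tendsto _
  have hc : ContinuousAt (fderiv ℝ β) (θ, y₀) :=
    (h.fderiv_right (m := 0) (by simp)).continuousAt
  have ht' : Tendsto (fun x : (E × E) × P => (x.2, y₀)) (𝓝 ((y₀, y₀), θ)) (𝓝 (θ, y₀)) := by
    have : Continuous (fun x : (E × E) × P => (x.2, y₀)) := by fun_prop
    exact this.tendsto _
  have hd := (hc.tendsto.comp ht').eventually (Metric.ball_mem_nhds _ (half_pos hε))
  filter_upwards [ht.eventually hs, hd] with x h1 h2
  set A := fderiv ℝ β (θ, y₀)
  set A' := fderiv ℝ β (x.2, y₀)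
  have hsub : ((x.2, x.1.1) : P × E) - (x.2, x.1.2) = (0, x.1.1 - x.1.2) := by simp
  have hn : ‖((0 : P), x.1.1 - x.1.2)‖ = ‖x.1.1 - x.1.2‖ := by simp [Prod.norm_def]
  rw [hsub, hn] at h1
  have h3 : ‖A' - A‖ ≤ ε / 2 := (mem_ball_iff_norm.1 h2).le
  have h4 := (A' - A).le_of_opNorm_le h3 ((0 : P), x.1.1 - x.1.2)
  rw [hn] at h4
  calc _ = ‖(β (x.2, x.1.1) - β (x.2, x.1.2) - A (0, x.1.1 - x.1.2)) -
        (A' - A) (0, x.1.1 - x.1.2)‖ := by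
        congr 1
        simp only [ContinuousLinearMap.comp_apply, ContinuousLinearMap.inr_apply,
          sub_apply]
        abel
    _ ≤ _ := (norm_sub_le _ _).trans (add_le_add h1 h4)
    _ = _ := by ring

end Uniform

/-! ### The torus action in a chart around a fixed point -/

section FixedPoints

variable {d m : ℕ} {M : Type*} [TopologicalSpace M] [ChartedSpace (EuclideanSpace ℝ (Fin d)) M]
  [MulAction (Fin m → Sp1) M]

/-- The action of the maximal torus in the preferred chart at `p`. -/
noncomputable def chartAction (d : ℕ) {m : ℕ} {M : Type*} [TopologicalSpace M]
    [ChartedSpace (EuclideanSpace ℝ (Fin d)) M] [MulAction (Fin m → Sp1) M] (p : M)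
    (t : UnitAddTorus (Fin m)) (y : EuclideanSpace ℝ (Fin d)) : EuclideanSpace ℝ (Fin d) :=
  extChartAt (𝓡 d) p (torus t • (extChartAt (𝓡 d) p).symm y)

theorem IsSmoothAction.continuous_torus_smul (h : IsSmoothAction d m M) :
    Continuous fun x : UnitAddTorus (Fin m) × M => torus x.1 • x.2 :=
  (ContMDiff.continuous h).comp
    ((continuous_torus.comp continuous_fst).prodMk continuous_snd)

/-- Tube lemma: the torus is compact and fixes `p`, so one neighbourhood of `p` is kept inside the
chart by all its elements at once. -/
theorem IsSmoothAction.eventually_forall_mem_source (h : IsSmoothAction d m M) {p : M}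
    (hp : ∀ t : UnitAddTorus (Fin m), torus t • p = p) :
    ∀ᶠ y in 𝓝 (extChartAt (𝓡 d) p p), ∀ t : UnitAddTorus (Fin m),
      torus t • (extChartAt (𝓡 d) p).symm y ∈ (extChartAt (𝓡 d) p).source := by
  have := isCompact_univ.eventually_forall_of_forall_eventually (X := EuclideanSpace ℝ (Fin d))
    (Y := UnitAddTorus (Fin m)) (x₀ := extChartAt (𝓡 d) p p) (P := fun y t =>
      torus t • (extChartAt (𝓡 d) p).symm y ∈ (extChartAt (𝓡 d) p).source) ?_
  · simpa using this
  intro t _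
  have hc : ContinuousAt (fun z : EuclideanSpace ℝ (Fin d) × UnitAddTorus (Fin m) =>
      torus z.2 • (extChartAt (𝓡 d) p).symm z.1) (extChartAt (𝓡 d) p p, t) := by
    have h1 : ContinuousAt (fun z : EuclideanSpace ℝ (Fin d) × UnitAddTorus (Fin m) =>
        (z.2, (extChartAt (𝓡 d) p).symm z.1)) (extChartAt (𝓡 d) p p, t) :=
      continuousAt_snd.prodMk
        (ContinuousAt.comp (g := (extChartAt (𝓡 d) p).symm) (f := Prod.fst)
          (continuousAt_extChartAt_symm p) continuousAt_fst)
    exact ContinuousAt.comp (g := fun x : UnitAddTorus (Fin m) × M => torus x.1 • x.2)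
      h.continuous_torus_smul.continuousAt h1
  refine hc.eventually ((isOpen_extChartAt_source (I := 𝓡 d) p).mem_nhds ?_)
  simp only [extChartAt_to_inv, hp]
  exact mem_extChartAt_source p

variable [IsManifold (𝓡 d) ∞ M]

/-- Parametrizing the torus by its covering `ℝ^m` turns joint smoothness into a statement between
normed spaces. -/
theorem IsSmoothAction.contDiffAt_chartAction (h : IsSmoothAction d m M) {p : M}
    (hp : ∀ t : UnitAddTorus (Fin m), torus t • p = p) (θ : Fin m → ℝ) :
    ContDiffAt ℝ ∞ (fun x : (Fin m → ℝ) × EuclideanSpace ℝ (Fin d) =>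
      chartAction d p (torusMk x.1) x.2) (θ, extChartAt (𝓡 d) p p) := by
  rw [← contMDiffAt_iff_contDiffAt]
  have h1 : ContMDiffAt 𝓘(ℝ, (Fin m → ℝ) × EuclideanSpace ℝ (Fin d))
      (𝓘(ℝ, Fin m → sp1).prod (𝓡 d)) ∞
      (fun x : (Fin m → ℝ) × EuclideanSpace ℝ (Fin d) =>
        (torusLog x.1, (extChartAt (𝓡 d) p).symm x.2)) (θ, extChartAt (𝓡 d) p p) := by
    refine ContMDiffAt.prodMk ?_ ?_
    · exact (torusLog.contDiff.comp contDiff_fst).contMDiff.contMDiffAt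
    · refine ContMDiffAt.comp (I' := 𝓘(ℝ, EuclideanSpace ℝ (Fin d)))
        (g := (extChartAt (𝓡 d) p).symm) (f := Prod.snd) (θ, extChartAt (𝓡 d) p p) ?_
        contDiff_snd.contMDiff.contMDiffAt
      exact (contMDiffOn_extChartAt_symm p).contMDiffAt
        (extChartAt_target_mem_nhds (I := 𝓡 d) p)
  have h2 := ContMDiffAt.comp (g := fun x : (Fin m → sp1) × M => expPow x.1 • x.2)
    (θ, extChartAt (𝓡 d) p p) h.contMDiff_exp_smul.contMDiffAt h1
  refine ContMDiffAt.comp (g := extChartAt (𝓡 d) p) (θ, extChartAt (𝓡 d) p p) ?_ h2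
  simp only [extChartAt_to_inv, hp]
  exact contMDiffAt_extChartAt

theorem IsSmoothAction.isLocalAction_chartAction (h : IsSmoothAction d m M) {p : M}
    (hp : ∀ t : UnitAddTorus (Fin m), torus t • p = p) :
    IsLocalAction (chartAction d p) (fun t : UnitAddTorus (Fin m) =>
      fderiv ℝ (chartAction d p t) (extChartAt (𝓡 d) p p)) (extChartAt (𝓡 d) p p) := by
  set β := fun x : (Fin m → ℝ) × EuclideanSpace ℝ (Fin d) => chartAction d p (torusMk x.1) x.2
    with hβ
  set y₀ := extChartAt (𝓡 d) p p with hy₀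
  have hD : ∀ θ, fderiv ℝ (chartAction d p (torusMk θ)) y₀ =
      (fderiv ℝ β (θ, y₀)).comp (ContinuousLinearMap.inr ℝ _ _) := by
    intro θ
    have h1 := ((h.contDiffAt_chartAction hp θ).differentiableAt (by simp)).hasFDerivAt
    exact (HasFDerivAt.comp (g := β) y₀ h1 (hasFDerivAt_prodMk_right θ y₀)).fderiv
  have htarget : ∀ᶠ y in 𝓝 y₀, y ∈ (extChartAt (𝓡 d) p).target := extChartAt_target_mem_nhds p
  have hsource := h.eventually_forall_mem_source hp
  constructor
  · intro t
    simp only [chartAction, hy₀]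
    rw [extChartAt_to_inv, hp]
  · rw [isOpenQuotientMap_torusMk.isQuotientMap.continuous_iff]
    have : (fun t : UnitAddTorus (Fin m) => fderiv ℝ (chartAction d p t) y₀) ∘ torusMk =
        fun θ => (fderiv ℝ β (θ, y₀)).comp (ContinuousLinearMap.inr ℝ _ _) := funext hD
    rw [this]
    refine Continuous.clm_comp (continuous_iff_continuousAt.2 fun θ => ?_) continuous_const
    have hc : ContinuousAt (fderiv ℝ β) (θ, y₀) :=
      ((h.contDiffAt_chartAction hp θ).fderiv_right (m := 0) (by simp)).continuousAt
    exact ContinuousAt.comp (g := fderiv ℝ β) (f := fun θ => (θ, y₀)) hc (by fun_prop)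
  · intro ε hε
    -- The unit cube is compact and covers the torus, so estimates local in `θ` become uniform in
    -- `t`.
    have := (isCompact_Icc (a := (0 : Fin m → ℝ)) (b := 1)).eventually_forall_of_forall_eventually
      (P := fun (z : EuclideanSpace ℝ (Fin d) × EuclideanSpace ℝ (Fin d)) θ =>
        ‖β (θ, z.1) - β (θ, z.2) - ((fderiv ℝ β (θ, y₀)).comp
          (ContinuousLinearMap.inr ℝ _ _)) (z.1 - z.2)‖ ≤ ε * ‖z.1 - z.2‖) (x₀ := (y₀, y₀))
      fun θ _ => eventually_approx_of_contDiffAt (h.contDiffAt_chartAction hp θ) hε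
    filter_upwards [this] with z hz t
    obtain ⟨θ, hθ, rfl⟩ := exists_mem_Icc_torusMk t
    rw [hD]
    exact hz θ hθ
  · filter_upwards [hsource] with y hy
    refine (continuousOn_extChartAt p).comp_continuous ?_ hy
    exact h.continuous_torus_smul.comp (Continuous.prodMk_left _)
  · filter_upwards [htarget] with y hy
    have h1 : torus (0 : UnitAddTorus (Fin m)) • (extChartAt (𝓡 d) p).symm y =
        (extChartAt (𝓡 d) p).symm y := by
      rw [torus_zero]
      exact one_smul (Fin m → Sp1) _
    rw [chartAction, h1, (extChartAt (𝓡 d) p).right_inv hy]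
  · filter_upwards [hsource] with y hy s t
    have h1 : torus (s + t) • (extChartAt (𝓡 d) p).symm y =
        torus s • torus t • (extChartAt (𝓡 d) p).symm y := by
      rw [torus_add]
      exact mul_smul (torus s) (torus t) ((extChartAt (𝓡 d) p).symm y)
    rw [chartAction, h1, chartAction, chartAction, (extChartAt (𝓡 d) p).left_inv (hy t)]

/-- A function with vanishing differential at the fixed points of the maximal torus is locally
constant on the fixed point set. -/
theorem IsSmoothAction.eventually_eq_of_fixed (h : IsSmoothAction d m M) {F : Type*}
    [NormedAddCommGroup F] [NormedSpace ℝ F] {f : M → F}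
    (hf : ∀ q : M, (∀ t : UnitAddTorus (Fin m), torus t • q = q) →
      HasMFDerivAt (𝓡 d) 𝓘(ℝ, F) f q (0 : EuclideanSpace ℝ (Fin d) →L[ℝ] F))
    {p : M} (hp : ∀ t : UnitAddTorus (Fin m), torus t • p = p) :
    ∀ᶠ q in 𝓝 p, (∀ t : UnitAddTorus (Fin m), torus t • q = q) → f q = f p := by
  set e := extChartAt (𝓡 d) p with he
  have hW : ∀ᶠ y in 𝓝 (e p), y ∈ e.target ∧ ∀ t : UnitAddTorus (Fin m),
      torus t • e.symm y ∈ e.source :=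
    Eventually.and (extChartAt_target_mem_nhds (I := 𝓡 d) p) (h.eventually_forall_mem_source hp)
  have key := (h.isLocalAction_chartAction hp).eventually_eq_of_fixed
    (volume : Measure (UnitAddTorus (Fin m))) hW (f := f ∘ e.symm) ?_
  · filter_upwards [(continuousAt_extChartAt (I := 𝓡 d) p).eventually key,
      extChartAt_source_mem_nhds (I := 𝓡 d) p] with q hq hqs hfix
    have := hq fun t => by
      rw [chartAction, (extChartAt (𝓡 d) p).left_inv hqs, hfix]
    simpa only [Function.comp_apply, he, extChartAt_to_inv, e.left_inv hqs,
      (extChartAt (𝓡 d) p).left_inv hqs] using this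
  · intro y hy hfix
    have hq : ∀ t : UnitAddTorus (Fin m), torus t • e.symm y = e.symm y := by
      intro t
      refine e.injOn (hy.2 t) (e.map_target hy.1) ?_
      rw [e.right_inv hy.1]
      exact hfix t
    have h1 : MDifferentiableAt 𝓘(ℝ, EuclideanSpace ℝ (Fin d)) (𝓡 d) e.symm y :=
      ((contMDiffOn_extChartAt_symm (n := ∞) p).contMDiffAt
        ((isOpen_extChartAt_target p).mem_nhds hy.1)).mdifferentiableAt (by simp)
    have h2 := ((hf _ hq).comp y h1.hasMFDerivAt).hasFDerivAt
    exact h2.congr_fderiv (ContinuousLinearMap.ext fun x => rfl)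

end FixedPoints

/-! ### Critical points of the tri-moment map, finiteness and convexity -/

section CriticalPoints

variable {d m : ℕ} {M : Type*} [TopologicalSpace M] [ChartedSpace (EuclideanSpace ℝ (Fin d)) M]

theorem _root_.IsLocalMax.hasMFDerivAt_eq_zero {f : M → ℝ} {p : M} (hf : IsLocalMax f p)
    {A : EuclideanSpace ℝ (Fin d) →L[ℝ] ℝ} (hA : HasMFDerivAt (𝓡 d) 𝓘(ℝ, ℝ) f p A) : A = 0 := by
  have h1 : HasFDerivWithinAt (f ∘ (extChartAt (𝓡 d) p).symm) A (range (𝓡 d))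
      (extChartAt (𝓡 d) p p) := hA.2
  rw [ModelWithCorners.range_eq_univ, hasFDerivWithinAt_univ] at h1
  refine IsLocalMax.hasFDerivAt_eq_zero ?_ h1
  have h2 : Tendsto (extChartAt (𝓡 d) p).symm (𝓝 (extChartAt (𝓡 d) p p)) (𝓝 p) := by
    have := continuousAt_extChartAt_symm (I := 𝓡 d) p
    rwa [ContinuousAt, extChartAt_to_inv] at this
  filter_upwards [h2.eventually hf] with y hy
  simpa using hy

theorem _root_.exteriorPower.ιMulti_ne_zero_of_linearIndependent {K W : Type*} [Field K]
    [AddCommGroup W] [Module K W] {n : ℕ} {w : Fin n → W} (hw : LinearIndependent K w) :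
    exteriorPower.ιMulti K n w ≠ 0 := by
  have h := (exteriorPower.ιMulti_family_linearIndependent_field n hw).ne_zero
    (Set.powersetCard.ofFinEmbEquiv (RelEmbedding.refl (· ≤ ·)))
  rw [exteriorPower.ιMulti_family, Equiv.symm_apply_apply] at h
  exact h

variable [MulAction (Fin m → Sp1) M] {ψ : Form d M 4} {σ : M → Fin m → ℝ}

theorem IsTriMomentMap.differential_apply (hσ : IsTriMomentMap ψ σ) (i : Fin m) (p : M)
    (v : TangentSpace (𝓡 d) p) :
    differential d (fun q => σ q i) p v =
      ψ p ![v, fundFieldAt d i basisH p, fundFieldAt d i basisX p, fundFieldAt d i basisY p] := by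
  have h := hσ.differential_eq p v (Pi.single i basisH) (Pi.single i basisX) (Pi.single i basisY)
  rw [Finset.sum_eq_single i, Finset.sum_eq_single i] at h
  · simp only [Pi.single_eq_same] at h
    rw [← h]
    simp [triVol, basisH, basisX, basisY, Matrix.det_fin_three]
  · intro j _ hj
    simp only [Pi.single_eq_of_ne hj]
    -- For `j ≠ i` all three Lie algebra entries are `0`, so two arguments of `ψ` coincide; the
    -- alternating property suffices.
    exact (ψ p).map_eq_zero_of_eq _ (i := 1) (j := 2) rfl (by decide)
  · simp
  · intro j _ hj
    simp [Pi.single_eq_of_ne hj, triVol, Matrix.det_fin_three]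
  · simp

theorem IsTriMomentMap.hasMFDerivAt (hσ : IsTriMomentMap ψ σ) (p : M) :
    HasMFDerivAt (𝓡 d) 𝓘(ℝ, Fin m → ℝ) σ p
      (ContinuousLinearMap.pi fun i => (differential d (fun q => σ q i) p :
        EuclideanSpace ℝ (Fin d) →L[ℝ] ℝ)) := by
  have h := (hσ.smooth.mdifferentiable (by simp) p).hasMFDerivAt
  refine h.congr_mfderiv (ContinuousLinearMap.ext fun v => funext fun i => ?_)
  have h1 : HasMFDerivAt 𝓘(ℝ, Fin m → ℝ) 𝓘(ℝ, ℝ) (fun x : Fin m → ℝ => x i) (σ p)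
      (ContinuousLinearMap.proj (R := ℝ) (φ := fun _ : Fin m => ℝ) i) :=
    (ContinuousLinearMap.proj (R := ℝ) (φ := fun _ : Fin m => ℝ) i).hasMFDerivAt
  have h2 := (h1.comp p h).mfderiv
  exact (congrArg (fun A : EuclideanSpace ℝ (Fin d) →L[ℝ] ℝ => A v) h2).symm

theorem fundFieldAt_basisH_eq_zero_of_fixed {q : M}
    (hq : ∀ t : UnitAddTorus (Fin m), torus t • q = q) (i : Fin m) :
    fundFieldAt d i basisH q = 0 := by
  have hfix : ∀ t : ℝ, expPow (t • (Pi.single i basisH : Fin m → sp1)) • q = q := by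
    intro t
    have : torusLog (Pi.single i (t / (2 * Real.pi))) = t • (Pi.single i basisH : Fin m → sp1) := by
      funext j
      rcases eq_or_ne j i with rfl | hj
      · have h0 := Real.two_pi_pos.ne'
        simp [torusLog, mul_div_cancel₀ t h0]
      · simp [torusLog, Pi.single_eq_of_ne hj]
    rw [← this, ← torus_torusMk, hq]
  have h1 : (fun t : ℝ => (fun j => expSp1 (t • (Pi.single i basisH : Fin m → sp1) j) :
      Fin m → Sp1) • q) = fun _ => q := funext hfix
  unfold fundFieldAt fundField
  rw [h1, mfderiv_const]
  rfl

/-- Points fixed by the maximal torus are critical. -/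
theorem IsTriMomentMap.hasMFDerivAt_zero_of_fixed (hσ : IsTriMomentMap ψ σ) {q : M}
    (hq : ∀ t : UnitAddTorus (Fin m), torus t • q = q) :
    HasMFDerivAt (𝓡 d) 𝓘(ℝ, Fin m → ℝ) σ q
      (0 : EuclideanSpace ℝ (Fin d) →L[ℝ] (Fin m → ℝ)) := by
  refine (hσ.hasMFDerivAt q).congr_mfderiv (ContinuousLinearMap.ext fun v => funext fun i => ?_)
  refine (hσ.differential_apply i q v).trans ?_
  exact (ψ q).map_coord_zero 1 (fundFieldAt_basisH_eq_zero_of_fixed hq i)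

variable {V : ∀ p : M, Fin m → Submodule ℝ (TangentSpace (𝓡 d) p)}
  {hV : IsStronglyNondegenerate ψ V} {L : ∀ p i, ⋀[ℝ]^3 (V p i) ≃ₗ[ℝ] V p i}
  {g : BilinField d M}

/-- At a critical point of `σ i`, the `i`-th factor has a stabilizer of positive dimension. -/
theorem IsPartitioned.exists_infinitesimal_eq_zero (hg : IsPartitioned hV L g)
    (hσ : IsTriMomentMap ψ σ) (h : IsSmoothAction d m M) {i : Fin m} {p : M}
    (hp : p ∈ Crit d (fun q => σ q i)) :
    ∃ u : sp1, u ≠ 0 ∧ infinitesimal d p (Pi.single i u) = 0 := by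
  -- By `metric_eq`, pairing this vector with any `w` gives `dσᵢ(w) = 0`.
  have h4 : L p i (exteriorPower.ιMulti ℝ 3 (triple hV i p)) = 0 := by
    apply Subtype.ext
    refine hg.isMetric.nondegenerate p _ fun w => ?_
    rw [hg.isMetric.symm, hg.metric_eq]
    refine (hσ.differential_apply i p w).symm.trans ?_
    have : differential d (fun q => σ q i) p = 0 := hp
    rw [this]
    rfl
  have hdep : ¬ LinearIndependent ℝ (triple hV i p) := fun hind =>
    exteriorPower.ιMulti_ne_zero_of_linearIndependent hind
      ((L p i).map_eq_zero_iff.1 h4)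
  obtain ⟨c, hc, k, hk⟩ := Fintype.not_linearIndependent_iff.1 hdep
  refine ⟨c 0 • basisH + c 1 • basisX + c 2 • basisY, fun hu => hk ?_, ?_⟩
  · have h0 : (c 0 • basisH + c 1 • basisX + c 2 • basisY : sp1).1 = 0 := congrArg Subtype.val hu
    have e0 : c 0 = 0 := by simpa using congrArg QuaternionAlgebra.imI h0
    have e1 : c 1 = 0 := by simpa using congrArg QuaternionAlgebra.imJ h0
    have e2 : c 2 = 0 := by simpa using congrArg QuaternionAlgebra.imK h0
    fin_cases k <;> assumption
  · rw [Pi.single_add, Pi.single_add, Pi.single_smul, Pi.single_smul, Pi.single_smul]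
    simp only [map_add, map_smul, ← h.fundFieldAt_eq]
    have := congrArg Subtype.val hc
    rw [Fin.sum_univ_three] at this
    exact this

/-- Every common critical point can be moved to a fixed point of the maximal torus. -/
theorem IsPartitioned.exists_smul_fixed [IsManifold (𝓡 d) ∞ M] (hg : IsPartitioned hV L g)
    (hσ : IsTriMomentMap ψ σ) (h : IsSmoothAction d m M) {p : M}
    (hp : p ∈ ⋂ i, Crit d (fun q => σ q i)) :
    ∃ a : Fin m → Sp1, ∀ t : UnitAddTorus (Fin m), torus t • a • p = a • p := by
  choose u hu hu' using fun i => hg.exists_infinitesimal_eq_zero hσ h (mem_iInter.1 hp i)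
  choose a c hac using fun i => exists_conj_basisH (hu i)
  refine ⟨a, fun t => ?_⟩
  obtain ⟨θ, rfl⟩ := isOpenQuotientMap_torusMk.surjective t
  -- Conjugation by `a` turns `expPow U` into `torus (torusMk θ)`. The field of `U` vanishes at `p`
  -- since each of its components does.
  set U : Fin m → sp1 := fun i => ((2 * Real.pi) * θ i) • c i • u i with hU
  have hU0 : infinitesimal d p U = 0 := by
    rw [← Finset.univ_sum_single U, map_sum]
    refine Finset.sum_eq_zero fun i _ => ?_
    rw [hU, Pi.single_smul, Pi.single_smul, map_smul, map_smul, hu', smul_zero, smul_zero]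
  have hfix := h.exp_smul_eq_self hU0 1
  rw [one_smul] at hfix
  have h1 : torus (torusMk θ) * a = a * expPow U := by
    funext i
    change expSp1 (((2 * Real.pi) * θ i) • basisH) * a i = a i * expSp1 (U i)
    rw [hac i]
    exact inv_mul_cancel_right _ _
  calc torus (torusMk θ) • a • p = (torus (torusMk θ) * a) • p :=
        (mul_smul (torus (torusMk θ)) a p).symm
    _ = a • expPow U • p := by rw [h1]; exact mul_smul a (expPow U) p
    _ = a • p := by rw [hfix]

/-- A locally constant function on the compact fixed point set has finite range, and invariance of
`σ` under the conjugating element places every value in `A` in that range. -/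
theorem IsPartitioned.finite_image_crit [T2Space M] [CompactSpace M] [IsManifold (𝓡 d) ∞ M]
    (hg : IsPartitioned hV L g) (hσ : IsTriMomentMap ψ σ) (h : IsSmoothAction d m M) :
    (σ '' ⋂ i, Crit d (fun q => σ q i)).Finite := by
  set S : Set M := {q | ∀ t : UnitAddTorus (Fin m), torus t • q = q} with hS
  have hclosed : IsClosed S := by
    rw [hS, ofPred_forall]
    exact isClosed_iInter fun t =>
      isClosed_eq (h.contMDiff_smul (torus t)).continuous continuous_id
  have : CompactSpace S := isCompact_iff_compactSpace.1 hclosed.isCompact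
  have hloc : IsLocallyConstant (fun q : S => σ q) := by
    rw [IsLocallyConstant.iff_eventually_eq]
    intro q
    have := h.eventually_eq_of_fixed (fun q hq => hσ.hasMFDerivAt_zero_of_fixed hq) q.2
    filter_upwards [continuous_subtype_val.continuousAt.eventually this] with x hx using hx x.2
  refine hloc.range_finite.subset ?_
  rintro _ ⟨p, hp, rfl⟩
  obtain ⟨a, ha⟩ := hg.exists_smul_fixed hσ h hp
  exact ⟨⟨a • p, ha⟩, hσ.invariant a p⟩

/-- A critical point of a combination of the `σ i` with non-zero coefficients is critical for each
of them. -/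
theorem IsPartitioned.mem_crit_of_combination (hg : IsPartitioned hV L g)
    (hσ : IsTriMomentMap ψ σ) {c : Fin m → ℝ} (hc : ∀ i, c i ≠ 0) {p : M}
    (hp : ∀ v : TangentSpace (𝓡 d) p, ∑ i, c i * differential d (fun q => σ q i) p v = 0) :
    p ∈ ⋂ i, Crit d (fun q => σ q i) := by
  -- Here `v ∈ V p j` and the fundamental vector of `H` in the `i`-th factor lie in different
  -- summands, so the partition condition applies.
  have hoff : ∀ i j, i ≠ j → ∀ v ∈ V p j, differential d (fun q => σ q i) p v = 0 := by
    intro i j hij v hv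
    rw [hσ.differential_apply]
    exact hg.partitioned p _ 0 1 j i hij.symm hv (hV.fundField_mem p i basisH) (by decide)
  refine mem_iInter.2 fun i => ContinuousLinearMap.ext fun v => ?_
  have hv : v ∈ ⨆ j, V p j := by
    rw [(hV.isInternal p).submodule_iSup_eq_top]
    trivial
  change differential d (fun q => σ q i) p v = 0
  induction hv using Submodule.iSup_induction' with
  | mem j v hv =>
    rcases eq_or_ne i j with rfl | hij
    · have := hp v
      rw [Finset.sum_eq_single i (fun k _ hk => by rw [hoff k i hk v hv, mul_zero])
        (by simp)] at this
      exact (mul_eq_zero.1 this).resolve_left (hc i)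
    · exact hoff i j hij v hv
  | zero => exact map_zero _
  | add v w _ _ hv hw => rw [map_add, hv, hw, add_zero]

theorem IsPartitioned.range_subset_convexHull [CompactSpace M]
    (hg : IsPartitioned hV L g) (hσ : IsTriMomentMap ψ σ)
    (hfin : (σ '' ⋂ i, Crit d (fun q => σ q i)).Finite) :
    range σ ⊆ convexHull ℝ (σ '' ⋂ i, Crit d (fun q => σ q i)) := by
  rintro _ ⟨p₀, rfl⟩
  by_contra hp₀
  obtain ⟨f, u, hlt, hu⟩ := geometric_hahn_banach_closed_point (convex_convexHull ℝ _)
    (hfin.isClosed_convexHull ℝ) hp₀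
  set c : Fin m → ℝ := fun i => f (Pi.single i 1) with hc
  have hf : ∀ x : Fin m → ℝ, f x = ∑ i, c i * x i := by
    intro x
    conv_lhs => rw [← Finset.univ_sum_single x, map_sum]
    refine Finset.sum_congr rfl fun i _ => ?_
    have : (Pi.single i (x i) : Fin m → ℝ) = x i • Pi.single i 1 := by
      rw [← Pi.single_smul, smul_eq_mul, mul_one]
    rw [this, map_smul, smul_eq_mul, mul_comm]
  -- The separating functional may have zero coefficients, and its maximum would then not be
  -- critical for every `σ i`. Adding a small `ε ≠ 0` to all coefficients removes the zeros.
  have h1 : ∀ᶠ ε in 𝓝[≠] (0 : ℝ), ∀ i, c i + ε ≠ 0 := by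
    refine eventually_all.2 fun i => ?_
    rcases eq_or_ne (c i) 0 with h0 | h0
    · filter_upwards [self_mem_nhdsWithin] with ε hε
      rwa [h0, zero_add]
    · refine eventually_nhdsWithin_of_eventually_nhds ?_
      have : ContinuousAt (fun ε : ℝ => c i + ε) 0 := by fun_prop
      exact this.eventually_ne (by simpa using h0)
  -- Finiteness of `A` makes the strict separation survive a single small `ε`.
  have h2 : ∀ᶠ ε in 𝓝[≠] (0 : ℝ), ∀ x ∈ σ '' ⋂ i, Crit d (fun q => σ q i),
      ∑ i, (c i + ε) * x i < ∑ i, (c i + ε) * σ p₀ i := by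
    refine (eventually_all_finite hfin).2 fun x hx => ?_
    refine eventually_nhdsWithin_of_eventually_nhds ?_
    have h3 : ContinuousAt (fun ε : ℝ => ∑ i, (c i + ε) * x i) 0 := by fun_prop
    have h4 : ContinuousAt (fun ε : ℝ => ∑ i, (c i + ε) * σ p₀ i) 0 := by fun_prop
    refine h3.eventually_lt h4 ?_
    simp only [add_zero, ← hf]
    exact (hlt x (subset_convexHull ℝ _ hx)).trans hu
  obtain ⟨ε, hε1, hε2⟩ := (h1.and h2).exists
  set ℓ : (Fin m → ℝ) →L[ℝ] ℝ := ∑ i, (c i + ε) •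
    ContinuousLinearMap.proj (R := ℝ) (φ := fun _ : Fin m => ℝ) i with hℓ
  have hℓa : ∀ x, ℓ x = ∑ i, (c i + ε) * x i := fun x => by simp [hℓ]
  have : Nonempty M := ⟨p₀⟩
  obtain ⟨p, hp⟩ := (ℓ.continuous.comp hσ.smooth.continuous).exists_forall_ge_of_hasCompactSupport
    (HasCompactSupport.of_compactSpace _)
  have hmem : p ∈ ⋂ i, Crit d (fun q => σ q i) := by
    refine hg.mem_crit_of_combination hσ hε1 fun v => ?_
    have hder := (ℓ.hasMFDerivAt (x := σ p)).comp p (hσ.hasMFDerivAt p)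
    have hmax : IsLocalMax (ℓ ∘ σ) p := Eventually.of_forall hp
    have h0 := congrArg (fun A : EuclideanSpace ℝ (Fin d) →L[ℝ] ℝ => A v)
      (hmax.hasMFDerivAt_eq_zero hder)
    refine Eq.trans ?_ h0
    exact (hℓa _).symm
  have hlast := hε2 _ ⟨p, hmem, rfl⟩
  rw [← hℓa, ← hℓa] at hlast
  exact absurd (hp p₀) (not_le.2 hlast)

end CriticalPoints

end Plectic

theorem mainTheorem1 (m : ℕ) (M : Type*) [TopologicalSpace M] [T2Space M] [CompactSpace M]
    [ConnectedSpace M] [ChartedSpace (EuclideanSpace ℝ (Fin (4 * m))) M]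
    [IsManifold (𝓡 (4 * m)) ∞ M] [MulAction (Fin m → Plectic.Sp1) M]
    (ψ : Plectic.Form (4 * m) M 4) (hψ : Plectic.IsFourPlectic ψ)
    (hact : Plectic.IsGeneralizedHamiltonian m ψ)
    (σ : M → Fin m → ℝ) (hσ : Plectic.IsTriMomentMap ψ σ)
    (V : ∀ p : M, Fin m → Submodule ℝ (TangentSpace (𝓡 (4 * m)) p))
    (hV : Plectic.IsStronglyNondegenerate ψ V)
    (L : ∀ p i, ⋀[ℝ]^3 (V p i) ≃ₗ[ℝ] V p i)
    (g : Plectic.BilinField (4 * m) M)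
    (hg : Plectic.IsPartitioned hV L g)
    (hcomm : ∀ j k : Fin m, j ≠ k → ∀ p : M,
      Plectic.differential (4 * m)
        (fun q => g q (Plectic.fourth hV L k q) (Plectic.fourth hV L k q)) p
        (Plectic.fourth hV L j p) = 0) :
    (σ '' ⋂ i, Plectic.Crit (4 * m) (fun p => σ p i)).Finite ∧
      Set.range σ ⊆ convexHull ℝ (σ '' ⋂ i, Plectic.Crit (4 * m) (fun p => σ p i)) := by
  have hfin := hg.finite_image_crit hσ hact.smooth
  exact ⟨hfin, hg.range_subset_convexHull hσ hfin⟩
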